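/- Let $\mathbf P$ be a set of propositions and let formulas be given by $\phi ::= p \mid \neg\phi \mid (\phi\wedge\phi)\mid \Box\phi\mid \boxdot\phi$ with $p\in\mathbf P$, where $\boxdot$ denotes the bundled "double box" modality. A Kripke model $\mathcal M=(S,R,V)$ consists of a non-empty set $S$, a relation $R\subseteq S\times S$ and a valuation $V:\mathbf P\to\mathcal P(S)$. For $s\in S$ let $\kappa_s=|\{t: sRt\}|$, let $L_s=\{t: sRt\text{ and }\exists u,\ tRu\}$ and $\lambda_s=|L_s|$; cardinals are identified with initial ordinals. It is assumed that for every $s\in S$ the cardinal of $\{(t,u): sRt,\ tRu\}$ is regular whenever it is infinite. Ordinal arithmetic is used throughout. For ordinals $\alpha,\beta,\gamma$, write $\beta\sim_\alpha\gamma$ iff $\beta=\gamma=0$ or ($\beta<\gamma\cdot\aleph_\alpha$ and $\gamma<\beta\cdot\aleph_\alpha$); this is an equivalence relation with classes $[\beta]_\alpha$, ordered by $[\beta]_\alpha<[\gamma]_\alpha$ iff $\beta\not\sim_\alpha\gamma$ and $\beta<\gamma$. For a family $(h(\gamma))_{\gamma<\lambda}$ of ordinals, $\sum h$ is the transfinite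 ordinal sum (with $0$ for the empty sum, ordinal addition at successor steps, suprema at limit steps). Fix arbitrarily, for every Kripke model and every world $s$, a bijection $f_s:\lambda_s\to L_s$ and, for each $t\in L_s$, a bijection $g_t:\kappa_t\to\{u:tRu\}$. Truth $\mathcal M,s\vDash\phi$ is defined as usual for propositions, $\neg$ and $\wedge$, and: - if $\kappa_s$ is infinite, $\mathcal M,s\vDash\Box\phi$ iff $|\{t:sRt,\ \mathcal M,t\vDash\phi\}|>|\{t:sRt,\ \mathcal M,t\nvDash\phi\}|$; otherwise $\mathcal M,s\vDash\Box\phi$ iff $\mathcal M,t\vDash\phi$ for all $t$ with $sRt$; - for $\gamma<\lambda_s$ and $t=f_s(\gamma)$ let $h(\gamma)=\kappa_t$, and let $h^+(\gamma)$ (resp. $h^-(\gamma)$) be the order type of the set of successors $u$ of $t$ with $\mathcal M,u\vDash\phi$ (resp. $\mathcal M,u\nvDash\phi$) in the well-order induced by $g_t$. If $|\sum h|=\aleph_\zeta$ is infinite, $\mathcal M,s\vDash\boxdot\phi$ iff $[\sum h^+]_\zeta>[\sum h^-]_\zeta$; otherwise $\mathcal M,s\vDash\boxdot\phi$ iff $\mathcal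 M,u\vDash\phi$ for all $t,u$ with $sRt$ and $tRu$. Then, for every formula $\phi$: $\phi$ is satisfiable in some Kripke model (i.e. true at some world of it) if and only if $\phi$ is satisfiable in some Kripke model $(S,R,V)$ with $|S|<\aleph_\omega$. -/

import Mathlib

open Cardinal Ordinal

universe u v

noncomputable section

/-! ### Ordinal arithmetic -/

namespace OrdArith

/-- `β ∼_α γ`: both are `0`, or `β < γ · ℵ_α` and `γ < β · ℵ_α` (ordinal multiplication, with `ℵ_α`
regarded as the initial ordinal `ω_ α`). When exactly one of `β`, `γ` is `0` the second alternative
fails. -/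
def Sim (α β γ : Ordinal.{u}) : Prop :=
  (β = 0 ∧ γ = 0) ∨ (β < γ * ω_ α ∧ γ < β * ω_ α)

/-- `[β]_α < [γ]_α` for the `∼_α`-classes of `β` and `γ`. -/
def ClassLT (α β γ : Ordinal.{u}) : Prop :=
  ¬ Sim α β γ ∧ β < γ

/-- The partial sum `∑_β f` of a family of ordinals indexed by the ordinals below `α`, by transfinite
recursion on `β`. It is only used for `β ≤ α` (past `α` the summands are read as `0`). -/
def partialSum {α : Ordinal.{u}} (f : Set.Iio α → Ordinal.{u}) (β : Ordinal.{u}) : Ordinal.{u} :=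
  open Classical in
  Ordinal.limitRecOn (motive := fun _ => Ordinal.{u}) β 0
    (fun γ s => s + if h : γ < α then f ⟨γ, h⟩ else 0)
    (fun γ _ s => ⨆ δ : Set.Iio γ, s δ.1 δ.2)

/-- The transfinite ordinal sum `∑ f` of a family indexed by the ordinals below `α`. -/
def transSum {α : Ordinal.{u}} (f : Set.Iio α → Ordinal.{u}) : Ordinal.{u} :=
  partialSum f α

/-- The relation on `A` obtained by pulling back the order of the ordinals along an injection. -/
def pullLT {A : Type u} {α : Ordinal.{u}} (g : A ↪ Set.Iio α) (a b : A) : Prop := g a < g b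

theorem pullLT_isWellOrder {A : Type u} {α : Ordinal.{u}} (g : A ↪ Set.Iio α) :
    IsWellOrder A (pullLT g) :=
  RelEmbedding.isWellOrder (⟨g, Iff.rfl⟩ : pullLT g ↪r ((· < ·) : Set.Iio α → Set.Iio α → Prop))

/-- The ordinal of the well-order that `A` inherits from an injection into the ordinals below `α`. -/
def pullType {A : Type u} {α : Ordinal.{u}} (g : A ↪ Set.Iio α) : Ordinal.{u} :=
  letI := pullLT_isWellOrder g
  Ordinal.type (pullLT g)

end OrdArith

/-! ### Language and models -/

/-- Formulas of duplex transfinite modal logic over the propositions `P`. -/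
inductive DTML (P : Type v) : Type v
  | prop (p : P) : DTML P
  | neg (φ : DTML P) : DTML P
  | conj (φ ψ : DTML P) : DTML P
  | box (φ : DTML P) : DTML P
  | boxbox (φ : DTML P) : DTML P

/-- A Kripke model: a non-empty set of worlds, an arbitrary binary relation and a valuation. -/
structure KripkeModel (P : Type v) where
  /-- the possible worlds -/
  World : Type u
  /-- there is a world -/
  nonempty : Nonempty World
  /-- the accessibility relation -/
  R : World → World → Prop
  /-- the valuation -/
  V : P → Set World

namespace KripkeModel

open OrdArith

variable {P : Type v} (M : KripkeModel.{u, v} P)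

/-- The set of successors of `s`. -/
def succs (s : M.World) : Set M.World := {t | M.R s t}

/-- The set of live successors of `s`: those that have a successor of their own. -/
def liveSuccs (s : M.World) : Set M.World := {t | M.R s t ∧ ∃ w, M.R t w}

/-- The successor cardinality `κ_s`. -/
def kap (s : M.World) : Cardinal.{u} := #(M.succs s)

/-- The live successor cardinality `λ_s`. -/
def lam (s : M.World) : Cardinal.{u} := #(M.liveSuccs s)

/-- A choice of the bijections used to evaluate `⊡⊡`: for each world `s` a bijection `f_s` from the
initial ordinal `λ_s` onto the live successors of `s`, and for each live successor `t` of `s` a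
bijection `g_t` from the initial ordinal `κ_t` onto the successors of `t` (it may depend on `s`). -/
structure Enumeration where
  /-- the bijection `f_s` -/
  f : ∀ s : M.World, Set.Iio (M.lam s).ord ≃ M.liveSuccs s
  /-- the bijections `g_t` -/
  g : ∀ (s : M.World) (t : M.liveSuccs s), Set.Iio (M.kap t).ord ≃ M.succs t

variable {M}

/-- `h : λ_s → Ord`, `h(γ) = κ_{f_s(γ)}`, a cardinal being identified with its initial ordinal. -/
def Enumeration.h (e : M.Enumeration) (s : M.World) (γ : Set.Iio (M.lam s).ord) : Ordinal.{u} :=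
  (M.kap (e.f s γ)).ord

/-- For a set `X` of worlds, the function `λ_s → Ord` that maps `γ` to the ordinal of the well-order
that `g_t`, for `t = f_s(γ)`, induces on the subset of those successors of `t` that lie in `X`. -/
def Enumeration.hOn (e : M.Enumeration) (s : M.World) (X : Set M.World)
    (γ : Set.Iio (M.lam s).ord) : Ordinal.{u} :=
  pullType (A := {w : M.succs (e.f s γ) // (w : M.World) ∈ X})
    ((Function.Embedding.subtype _).trans (e.g s (e.f s γ)).symm.toEmbedding)

/-- The satisfaction relation `M, s ⊨ φ`, evaluated with the bijections `e`. -/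
def Sat (e : M.Enumeration) : DTML P → M.World → Prop
  | .prop p, s => s ∈ M.V p
  | .neg φ, s => ¬ Sat e φ s
  | .conj φ ψ, s => Sat e φ s ∧ Sat e ψ s
  | .box φ, s =>
      (ℵ₀ ≤ M.kap s ∧
        #{t : M.World // M.R s t ∧ ¬ Sat e φ t} < #{t : M.World // M.R s t ∧ Sat e φ t}) ∨
      (M.kap s < ℵ₀ ∧ ∀ t, M.R s t → Sat e φ t)
  | .boxbox φ, s =>
      (∃ ζ : Ordinal.{u}, (transSum (e.h s)).card = ℵ_ ζ ∧
        ClassLT ζ (transSum (e.hOn s {w | ¬ Sat e φ w})) (transSum (e.hOn s {w | Sat e φ w}))) ∨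
      ((transSum (e.h s)).card < ℵ₀ ∧ ∀ t w, M.R s t → M.R t w → Sat e φ w)

variable (M)

/-- The standing regularity assumption, in its weakest useful form: for every world `s`, the cardinal
`|∑ h|`, which is the number of pairs `(t, w)` with `s R t` and `t R w`, is regular if infinite.
(This is what makes the evaluation of `⊡⊡` independent of the bijections.) -/
def Regular : Prop :=
  ∀ s : M.World, ℵ₀ ≤ #{q : M.World × M.World // M.R s q.1 ∧ M.R q.1 q.2} →
    (#{q : M.World × M.World // M.R s q.1 ∧ M.R q.1 q.2}).IsRegular

/-- The bijections can always be chosen. -/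
theorem nonempty_enumeration : Nonempty M.Enumeration := by
  have key : ∀ A : Type u, Nonempty (Set.Iio (#A).ord ≃ A) := fun A => by
    rw [← Cardinal.lift_mk_eq'.{u + 1, u}]
    simp
  exact ⟨⟨fun s => (key _).some, fun s t => (key _).some⟩⟩

end KripkeModel

end

/-!
Write `c` for the number of two-step paths from `s`. The sum that evaluates a double box at `s` on a
set `X` has at most `c` summands, each of them at most `c`. As `c` is regular, this sum is `c * c`
if and only if `c` of the summands equal `c`, and it is below `c` if and only if no summand equals
`c` and fewer than `c` of them are nonzero. These two thresholds decide the comparison of classes: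
all values from `c` up to but excluding `c * c` are in one class, and the sums on `X` and on its
complement are not both below `c`. Hence the truth of a modal formula at `s` is decided by comparing
finitely many cardinals, namely `c` and the numbers of successors of `s` in certain sets.

To shrink a model, keep one successor of `s` for each way of meeting the finitely many sets that
matter, and remember how many successors it represents. Then replace these multiplicities by
cardinals below `ℵ_ ω`, by a map on cardinals that commutes with finite sums and preserves all
comparisons with the finitely many cardinals that matter. The result is regular again because every
infinite cardinal below `ℵ_ ω` is regular.
-/

/-! ### Transfinite sums -/

namespace OrdArith

open Classical in
/-- A family of ordinals indexed by the ordinals below `α`, extended by zero to all ordinals: the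
summands that `partialSum` really adds. -/
noncomputable def extend {α : Ordinal.{u}} (f : Set.Iio α → Ordinal.{u}) (γ : Ordinal.{u}) :
    Ordinal.{u} :=
  if h : γ < α then f ⟨γ, h⟩ else 0

section PartialSum

variable {α : Ordinal.{u}} (f : Set.Iio α → Ordinal.{u})

theorem extend_of_lt {γ : Ordinal.{u}} (h : γ < α) : extend f γ = f ⟨γ, h⟩ := dif_pos h

theorem extend_of_le {γ : Ordinal.{u}} (h : α ≤ γ) : extend f γ = 0 := dif_neg h.not_gt

theorem extend_le {b : Ordinal.{u}} (hf : ∀ γ, f γ ≤ b) (γ : Ordinal.{u}) : extend f γ ≤ b := by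
  unfold extend
  split_ifs
  exacts [hf _, zero_le]

theorem extend_lt {b : Ordinal.{u}} (hb : 0 < b) (hf : ∀ γ, f γ < b) (γ : Ordinal.{u}) :
    extend f γ < b := by
  unfold extend
  split_ifs
  exacts [hf _, hb]

theorem partialSum_zero : partialSum f 0 = 0 :=
  Ordinal.limitRecOn_zero ..

theorem partialSum_add_one (γ : Ordinal.{u}) :
    partialSum f (γ + 1) = partialSum f γ + extend f γ :=
  Ordinal.limitRecOn_add_one ..

theorem partialSum_limit {γ : Ordinal.{u}} (hγ : Order.IsSuccLimit γ) :
    partialSum f γ = ⨆ δ : Set.Iio γ, partialSum f δ :=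
  Ordinal.limitRecOn_limit _ _ _ _ hγ

theorem partialSum_limit_le_iff {γ b : Ordinal.{u}} (hγ : Order.IsSuccLimit γ) :
    partialSum f γ ≤ b ↔ ∀ δ < γ, partialSum f δ ≤ b := by
  rw [partialSum_limit f hγ, Ordinal.iSup_le_iff, Subtype.forall]
  rfl

theorem partialSum_mono : Monotone (partialSum f) := by
  intro β δ h
  induction δ using Ordinal.limitRecOn with
  | zero => rw [nonpos_iff_eq_zero.1 h]
  | add_one δ ih =>
    rcases h.eq_or_lt with rfl | h
    · rfl
    · rw [partialSum_add_one]
      exact (ih (Order.le_of_lt_add_one h)).trans le_self_add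
  | limit δ hδ _ =>
    rcases h.eq_or_lt with rfl | h
    · rfl
    · exact (partialSum_limit_le_iff f hδ).1 le_rfl β h

theorem partialSum_add_le {γ δ : Ordinal.{u}} (h : γ < δ) :
    partialSum f γ + extend f γ ≤ partialSum f δ := by
  rw [← partialSum_add_one]
  exact partialSum_mono f (Order.add_one_le_of_lt h)

theorem partialSum_add_lt {γ δ x : Ordinal.{u}} (h : γ < δ) (hx : x < extend f γ) :
    partialSum f γ + x < partialSum f δ :=
  (add_lt_add_right hx _).trans_le (partialSum_add_le f h)

theorem exists_partialSum_le_lt_add {β x : Ordinal.{u}} (hx : x < partialSum f β) :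
    ∃ γ < β, partialSum f γ ≤ x ∧ x < partialSum f γ + extend f γ := by
  induction β using Ordinal.limitRecOn with
  | zero => simp [partialSum_zero] at hx
  | add_one β ih =>
    rcases lt_or_ge x (partialSum f β) with h | h
    · obtain ⟨γ, hγ, hxγ⟩ := ih h
      exact ⟨γ, hγ.trans (lt_add_one β), hxγ⟩
    · exact ⟨β, lt_add_one β, h, by rwa [← partialSum_add_one]⟩
  | limit β hβ ih =>
    obtain ⟨δ, hδ, hxδ⟩ : ∃ δ < β, x < partialSum f δ := by
      simpa only [not_forall, not_le, exists_prop] using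
        mt (partialSum_limit_le_iff f hβ).2 hx.not_ge
    obtain ⟨γ, hγ, hxγ⟩ := ih δ hδ hxδ
    exact ⟨γ, hγ.trans hδ, hxγ⟩

theorem bijective_partialSum_add (β : Ordinal.{u}) :
    Function.Bijective fun p : Σ γ : Set.Iio β, Set.Iio (extend f γ) =>
      (⟨partialSum f p.1 + p.2, partialSum_add_lt f p.1.2 p.2.2⟩ : Set.Iio (partialSum f β)) := by
  constructor
  · rintro ⟨⟨γ, hγ⟩, ⟨y, hy⟩⟩ ⟨⟨δ, hδ⟩, ⟨z, hz⟩⟩ h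
    replace h : partialSum f γ + y = partialSum f δ + z := congrArg Subtype.val h
    rcases lt_trichotomy γ δ with hlt | rfl | hlt
    · exact absurd (h ▸ partialSum_add_lt f hlt hy) le_self_add.not_gt
    · obtain rfl : y = z := add_left_cancel h
      rfl
    · exact absurd (h ▸ partialSum_add_lt f hlt hz) le_self_add.not_gt
  · rintro ⟨x, hx⟩
    obtain ⟨γ, hγ, hle, hlt⟩ := exists_partialSum_le_lt_add f hx
    exact ⟨⟨⟨γ, hγ⟩, ⟨x - partialSum f γ, (Ordinal.sub_lt_of_le hle).2 hlt⟩⟩,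
      Subtype.ext (Ordinal.add_sub_cancel_of_le hle)⟩

theorem lift_card_partialSum (β : Ordinal.{u}) :
    Cardinal.lift.{u + 1} (partialSum f β).card =
      Cardinal.sum fun γ : Set.Iio β => Cardinal.lift.{u + 1} (extend f γ).card := by
  have h := Cardinal.mk_congr (Equiv.ofBijective _ (bijective_partialSum_add f β))
  simpa only [Cardinal.mk_sigma, Cardinal.mk_Iio_ordinal] using h.symm

theorem card_transSum {ι : Type u} (e : Set.Iio α ≃ ι) :
    (transSum f).card = Cardinal.sum fun i : ι => (f (e.symm i)).card := by
  have hterm (γ : Set.Iio α) : Cardinal.lift.{u} #(Set.Iio (extend f γ)) =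
      Cardinal.lift.{u + 1} #(f (e.symm (e γ))).ToType := by
    simp [Cardinal.mk_Iio_ordinal, extend_of_lt f γ.2]
  have h := (Cardinal.mk_sigma_congr_lift (g := fun i => (f (e.symm i)).ToType) e hterm).symm.trans
    (congrArg Cardinal.lift.{u}
      (Cardinal.mk_congr (Equiv.ofBijective _ (bijective_partialSum_add f α))))
  rw [Cardinal.mk_Iio_ordinal, Cardinal.mk_sigma] at h
  rw [← Cardinal.lift_inj.{u, u + 1}, Cardinal.lift_sum]
  simpa [transSum] using h.symm

theorem partialSum_lt_ord {c : Cardinal.{u}} (hc : c.IsRegular) (hf : ∀ γ, f γ < c.ord)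
    {β : Ordinal.{u}} (hβ : β < c.ord) : partialSum f β < c.ord := by
  rw [Cardinal.lt_ord, ← Cardinal.lift_lt.{u, u + 1}, lift_card_partialSum]
  refine Cardinal.sum_lt_of_isRegular hc.lift ?_ fun γ => ?_
  · rw [Cardinal.mk_Iio_ordinal, Cardinal.lift_lt]
    exact Cardinal.lt_ord.1 hβ
  · rw [Cardinal.lift_lt, ← Cardinal.lt_ord]
    exact extend_lt f hc.ord_pos hf γ

theorem partialSum_le_ord {c : Cardinal.{u}} (hc : c.IsRegular) (hf : ∀ γ, f γ < c.ord)
    {β : Ordinal.{u}} (hβ : β ≤ c.ord) : partialSum f β ≤ c.ord := by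
  refine (partialSum_mono f hβ).trans ?_
  exact (partialSum_limit_le_iff f (Cardinal.isSuccLimit_ord hc.aleph0_le)).2
    fun δ hδ => (partialSum_lt_ord f hc hf hδ).le

theorem partialSum_le_mul {b : Ordinal.{u}} (hf : ∀ γ, f γ ≤ b) (β : Ordinal.{u}) :
    partialSum f β ≤ b * β := by
  induction β using Ordinal.limitRecOn with
  | zero => simp [partialSum_zero]
  | add_one β ih =>
    rw [partialSum_add_one, mul_add_one]
    exact add_le_add ih (extend_le f hf β)
  | limit β hβ ih =>
    exact (partialSum_limit_le_iff f hβ).2 fun δ hδ => (ih δ hδ).trans (mul_le_mul_right hδ.le _)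

theorem partialSum_le_add {α' : Ordinal.{u}} (f' : Set.Iio α' → Ordinal.{u}) {β₀ : Ordinal.{u}}
    (h : ∀ γ, β₀ ≤ γ → extend f γ ≤ extend f' γ) (β : Ordinal.{u}) :
    partialSum f β ≤ partialSum f β₀ + partialSum f' β := by
  induction β using Ordinal.limitRecOn with
  | zero => simp [partialSum_zero]
  | add_one β ih =>
    rcases lt_or_ge β β₀ with hβ | hβ
    · exact (partialSum_mono f (Order.add_one_le_of_lt hβ)).trans le_self_add
    · rw [partialSum_add_one, partialSum_add_one, ← add_assoc]
      exact add_le_add ih (h β hβ)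
  | limit β hβ ih =>
    exact (partialSum_limit_le_iff f hβ).2 fun δ hδ =>
      (ih δ hδ).trans (add_le_add_right (partialSum_mono f' hδ.le) _)

theorem partialSum_div_lt_partialSum_div {a γ δ : Ordinal.{u}} (ha : a ≠ 0) (hγ : a ≤ extend f γ)
    (h : γ < δ) : partialSum f γ / a < partialSum f δ / a := by
  rw [← Order.add_one_le_iff, ← Ordinal.mul_le_iff_le_div ha, mul_add_one]
  exact (add_le_add (Ordinal.mul_div_le _ _) hγ).trans (partialSum_add_le f h)

end PartialSum

section TransSum

variable {α : Ordinal.{u}} {f : Set.Iio α → Ordinal.{u}} {ι : Type u} (e : Set.Iio α ≃ ι)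

theorem mk_le_card_of_transSum_lt_mul {a b : Ordinal.{u}} (h : transSum f < a * b) :
    #{i : ι // a ≤ f (e.symm i)} ≤ b.card := by
  have ha : a ≠ 0 := by
    rintro rfl
    simp at h
  let quotient (γ : Set.Iio α) : Set.Iio b := ⟨partialSum f γ / a,
    (Ordinal.lt_mul_iff_div_lt ha).1 ((partialSum_mono f γ.2.le).trans_lt h)⟩
  have quotient_lt {γ δ : Set.Iio α} (hγ : a ≤ f γ) (hlt : γ < δ) : quotient γ < quotient δ :=
    partialSum_div_lt_partialSum_div f ha (hγ.trans_eq (extend_of_lt f γ.2).symm) hlt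
  have injective : Function.Injective
      fun i : {i : ι // a ≤ f (e.symm i)} => quotient (e.symm i) := by
    rintro ⟨i, hi⟩ ⟨j, hj⟩ hij
    rcases lt_trichotomy (e.symm i) (e.symm j) with hlt | heq | hlt
    · exact absurd hij (quotient_lt hi hlt).ne
    · exact Subtype.ext (e.symm.injective heq)
    · exact absurd hij (quotient_lt hj hlt).ne'
  have h := Cardinal.lift_mk_le_lift_mk_of_injective injective
  rw [Cardinal.mk_Iio_ordinal, Cardinal.lift_lift] at h
  exact Cardinal.lift_le.1 h

variable {c : Cardinal.{u}}

theorem transSum_lt_mul_self (hc : c.IsRegular) (hα : α ≤ c.ord)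
    (hf : ∀ γ, f γ ≤ c.ord) (h : #{i : ι // c.ord ≤ f (e.symm i)} < c) :
    transSum f < c.ord * c.ord := by
  classical
  -- By regularity some `β₀ < c.ord` bounds the indices of all summands equal to `c.ord`, and the
  -- summands from `β₀` on add at most `c.ord`.
  let β₀ : Ordinal.{u} := ⨆ i : {i : ι // c.ord ≤ f (e.symm i)}, ((e.symm i : Ordinal) + 1)
  have hβ₀ : β₀ < c.ord :=
    Ordinal.iSup_add_one_lt_of_lt_cof (hc.cof_ord.symm ▸ h) fun i => (e.symm i).2.trans_le hα
  let light (γ : Set.Iio α) : Ordinal.{u} := if c.ord ≤ f γ then 0 else f γ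
  have hlight (γ) : light γ < c.ord := by
    unfold light
    split_ifs with hγ
    exacts [hc.ord_pos, not_le.1 hγ]
  have extend_le_light (γ) (hγ : β₀ ≤ γ) : extend f γ ≤ extend light γ := by
    rcases lt_or_ge γ α with hγα | hγα
    · have : ¬ c.ord ≤ f ⟨γ, hγα⟩ := fun hheavy => hγ.not_gt <|
        Ordinal.lt_iSup_add_one_iff.2 ⟨⟨e ⟨γ, hγα⟩, by simpa using hheavy⟩, by simp⟩
      simp [extend_of_lt _ hγα, light, this]
    · simp [extend_of_le _ hγα]
  calc transSum f
      ≤ partialSum f β₀ + partialSum light α := partialSum_le_add f light extend_le_light α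
    _ ≤ c.ord * β₀ + c.ord :=
        add_le_add (partialSum_le_mul f hf β₀) (partialSum_le_ord light hc hlight hα)
    _ = c.ord * (β₀ + 1) := (mul_add_one _ _).symm
    _ < c.ord * c.ord := mul_lt_mul_of_pos_left
        ((Cardinal.isSuccLimit_ord hc.aleph0_le).add_one_lt hβ₀) hc.ord_pos

theorem mul_self_le_transSum_iff (hc : c.IsRegular) (hα : α ≤ c.ord)
    (hf : ∀ γ, f γ ≤ c.ord) :
    c.ord * c.ord ≤ transSum f ↔ c ≤ #{i : ι // c.ord ≤ f (e.symm i)} := by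
  refine ⟨fun h => ?_, fun h => ?_⟩
  · by_contra! hlt
    exact (transSum_lt_mul_self e hc hα hf hlt).not_ge h
  · by_contra! hlt
    obtain ⟨b, hb, hlt⟩ :=
      (Ordinal.lt_mul_iff_of_isSuccLimit (Cardinal.isSuccLimit_ord hc.aleph0_le)).1 hlt
    exact (h.trans (mk_le_card_of_transSum_lt_mul e hlt)).not_gt (Cardinal.lt_ord.1 hb)

end TransSum

section ClassLT

theorem mul_eq_mul_self_of_isPrincipal {Ω β : Ordinal.{u}} (hΩ : Ordinal.IsPrincipal (· * ·) Ω)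
    (hlim : Order.IsSuccLimit Ω) (hle : Ω ≤ β) (hlt : β < Ω * Ω) : β * Ω = Ω * Ω := by
  obtain ⟨b, hb, hβb⟩ := (Ordinal.lt_mul_iff_of_isSuccLimit hlim).1 hlt
  have hb0 : 0 < b := pos_of_ne_zero fun h => by simp [h] at hβb
  refine le_antisymm ?_ (mul_le_mul_left hle Ω)
  calc β * Ω ≤ Ω * b * Ω := mul_le_mul_left hβb.le Ω
    _ = Ω * Ω := by rw [mul_assoc, Ordinal.isPrincipal_mul_iff_mul_left_eq.1 hΩ b hb0 hb]

theorem classLT_iff {ζ β γ : Ordinal.{u}} : ClassLT ζ β γ ↔ γ ≠ 0 ∧ β * ω_ ζ ≤ γ := by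
  have one_lt : 1 < ω_ ζ := Ordinal.one_lt_omega0.trans_le (Ordinal.omega0_le_omega ζ)
  unfold ClassLT Sim
  constructor
  · rintro ⟨hsim, hlt⟩
    refine ⟨(bot_le.trans_lt hlt).ne', ?_⟩
    by_contra! h
    exact hsim (.inr ⟨hlt.trans_le (le_mul_of_one_le_right' one_lt.le), h⟩)
  · rintro ⟨hγ, hle⟩
    refine ⟨by simp [hγ, hle.not_gt], ?_⟩
    rcases eq_or_ne β 0 with rfl | hβ
    · exact pos_iff_ne_zero.2 hγ
    · exact (lt_mul_of_one_lt_right (pos_iff_ne_zero.2 hβ) one_lt).trans_le hle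

theorem classLT_iff_of_le_mul_self {ζ β γ : Ordinal.{u}} (hβ : β ≤ ω_ ζ * ω_ ζ)
    (hγ : γ ≤ ω_ ζ * ω_ ζ) (h : β < ω_ ζ → ω_ ζ ≤ γ) :
    ClassLT ζ β γ ↔ β < ω_ ζ * ω_ ζ ∧ (ω_ ζ * ω_ ζ ≤ γ ∨ β < ω_ ζ) := by
  have one_lt : 1 < ω_ ζ := Ordinal.one_lt_omega0.trans_le (Ordinal.omega0_le_omega ζ)
  have pos : 0 < ω_ ζ := zero_lt_one.trans one_lt
  have hlim : Order.IsSuccLimit (ω_ ζ) :=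
    Cardinal.ord_aleph ζ ▸ Cardinal.isSuccLimit_ord (Cardinal.aleph0_le_aleph ζ)
  have principal : Ordinal.IsPrincipal (· * ·) (ω_ ζ) := Ordinal.isPrincipal_mul_omega ζ
  have lt_square {x : Ordinal.{u}} (hx : x < ω_ ζ) : x < ω_ ζ * ω_ ζ :=
    hx.trans (lt_mul_of_one_lt_right pos one_lt)
  rw [classLT_iff]
  rcases lt_or_ge β (ω_ ζ) with hlt | hge
  · have hle : β * ω_ ζ ≤ ω_ ζ := by
      rcases eq_or_ne β 0 with rfl | hβ0
      · simp
      · exact (Ordinal.isPrincipal_mul_iff_mul_left_eq.1 principal β (pos_iff_ne_zero.2 hβ0) hlt).le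
    simp [hlt, lt_square hlt, (pos.trans_le (h hlt)).ne', hle.trans (h hlt)]
  · rcases hβ.lt_or_eq with hlt | rfl
    · have : γ ≠ 0 ∧ ω_ ζ * ω_ ζ ≤ γ ↔ ω_ ζ * ω_ ζ ≤ γ :=
        and_iff_right_of_imp fun hle => ((mul_pos pos pos).trans_le hle).ne'
      simp [mul_eq_mul_self_of_isPrincipal principal hlim hge hlt, hlt, hge.not_gt, this]
    · have := hγ.trans_lt (lt_mul_of_one_lt_right (mul_pos pos pos) one_lt)
      simp [this.not_ge]

end ClassLT

theorem pullType_le {A : Type u} {α : Ordinal.{u}} (g : A ↪ Set.Iio α) : pullType g ≤ α := by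
  let := pullLT_isWellOrder g
  refine le_of_le_of_eq ?_ (Ordinal.type_toType α)
  exact Ordinal.type_le_iff'.2
    ⟨⟨g.trans Ordinal.ToType.mk.toEmbedding, Ordinal.ToType.mk.lt_iff_lt⟩⟩

theorem card_pullType {A : Type u} {α : Ordinal.{u}} (g : A ↪ Set.Iio α) :
    (pullType g).card = #A := rfl

end OrdArith

/-! ### Cardinals below `ℵ_ ω` -/

theorem isRegular_of_lt_aleph_omega0 {c : Cardinal.{u}} (h : ℵ₀ ≤ c) (hc : c < ℵ_ ω) :
    c.IsRegular := by
  obtain ⟨o, rfl⟩ := Cardinal.mem_range_aleph_iff.2 h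
  obtain ⟨n, rfl⟩ := Ordinal.lt_omega0.1 (Cardinal.aleph_lt_aleph.1 hc)
  cases n with
  | zero => simpa only [Nat.cast_zero, Cardinal.aleph_zero] using Cardinal.isRegular_aleph0
  | succ n => exact_mod_cast Cardinal.isRegular_aleph_add_one (n : Ordinal)

theorem cardinal_sum_equiv {ι κ : Type u} (e : ι ≃ κ) (f : κ → Cardinal.{v}) :
    (Cardinal.sum fun i => f (e i)) = Cardinal.sum f :=
  Cardinal.mk_congr (Equiv.sigmaCongrLeft (β := fun i => (f i).out) e)

theorem cardinal_sum_option {ι : Type u} (f : Option ι → Cardinal.{u}) :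
    Cardinal.sum f = f none + Cardinal.sum fun i => f (some i) := by
  let e : (Σ i, (f i).out) ≃ (f none).out ⊕ Σ i, (f (some i)).out :=
    { toFun := fun
        | ⟨none, x⟩ => .inl x
        | ⟨some i, x⟩ => .inr ⟨i, x⟩
      invFun := fun
        | .inl x => ⟨none, x⟩
        | .inr ⟨i, x⟩ => ⟨some i, x⟩
      left_inv := by rintro ⟨_ | i, x⟩ <;> rfl
      right_inv := by rintro (x | ⟨i, x⟩) <;> rfl }
  simpa using Cardinal.mk_congr e

theorem cardinal_sum_eq_finset_sum {ι : Type u} [Fintype ι] (f : ι → Cardinal.{u}) :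
    Cardinal.sum f = ∑ i, f i := by
  refine Fintype.induction_empty_option
    (P := fun ι _ => ∀ f : ι → Cardinal.{u}, Cardinal.sum f = ∑ i, f i)
    (fun ι κ _ e ih f => ?_) (fun f => by simp [Cardinal.sum])
    (fun ι _ ih f => by rw [cardinal_sum_option, ih, Fintype.sum_option]) ι f
  let := Fintype.ofEquiv κ e.symm
  rw [← cardinal_sum_equiv e, ih, Equiv.sum_comp e]

section AlephCollapse

open Classical in
/-- The map on cardinals that fixes the finite ones and sends an infinite cardinal `c` to `ℵ_ n`,
where `n` is the number of elements of `C` that are at most `c`. It preserves all comparisons with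
elements of `C`, and all its infinite values are below `ℵ_ ω`. -/
noncomputable def alephCollapse (C : Finset Cardinal.{u}) (c : Cardinal.{u}) : Cardinal.{u} :=
  if c < ℵ₀ then c else ℵ_ ((C.filter (· ≤ c)).card : Ordinal.{u})

variable {C : Finset Cardinal.{u}} {a b c : Cardinal.{u}}

theorem alephCollapse_of_lt_aleph0 (h : c < ℵ₀) : alephCollapse C c = c := if_pos h

theorem alephCollapse_of_aleph0_le [DecidablePred (· ≤ c)] (h : ℵ₀ ≤ c) :
    alephCollapse C c = ℵ_ ((C.filter (· ≤ c)).card : Ordinal.{u}) := by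
  rw [alephCollapse, if_neg h.not_gt]
  congr!

theorem aleph0_le_alephCollapse_iff : ℵ₀ ≤ alephCollapse C c ↔ ℵ₀ ≤ c := by
  classical
  rcases lt_or_ge c ℵ₀ with h | h
  · rw [alephCollapse_of_lt_aleph0 h]
  · simp [alephCollapse_of_aleph0_le h, Cardinal.aleph0_le_aleph, h]

theorem alephCollapse_lt_aleph0_iff : alephCollapse C c < ℵ₀ ↔ c < ℵ₀ := by
  rw [← not_le, aleph0_le_alephCollapse_iff, not_le]

theorem alephCollapse_eq_zero_iff : alephCollapse C c = 0 ↔ c = 0 := by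
  rcases lt_or_ge c ℵ₀ with h | h
  · rw [alephCollapse_of_lt_aleph0 h]
  · have h' := aleph0_le_alephCollapse_iff (C := C).2 h
    simp [(Cardinal.aleph0_pos.trans_le h).ne', (Cardinal.aleph0_pos.trans_le h').ne']

theorem alephCollapse_mono : Monotone (alephCollapse C) := by
  classical
  intro a b hab
  rcases lt_or_ge a ℵ₀ with ha | ha
  · rw [alephCollapse_of_lt_aleph0 ha]
    rcases lt_or_ge b ℵ₀ with hb | hb
    · rwa [alephCollapse_of_lt_aleph0 hb]
    · exact ha.le.trans (aleph0_le_alephCollapse_iff.2 hb)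
  · rw [alephCollapse_of_aleph0_le ha, alephCollapse_of_aleph0_le (ha.trans hab),
      Cardinal.aleph_le_aleph, Nat.cast_le]
    exact Finset.card_le_card (Finset.monotone_filter_right C fun _ _ h => h.trans hab)

theorem alephCollapse_lt_iff (hb : b ∈ C) : alephCollapse C a < alephCollapse C b ↔ a < b := by
  classical
  refine ⟨alephCollapse_mono.reflect_lt, fun hab => ?_⟩
  rcases lt_or_ge a ℵ₀ with ha | ha
  · rw [alephCollapse_of_lt_aleph0 ha]
    rcases lt_or_ge b ℵ₀ with hb | hb
    · rwa [alephCollapse_of_lt_aleph0 hb]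
    · exact ha.trans_le (aleph0_le_alephCollapse_iff.2 hb)
  · rw [alephCollapse_of_aleph0_le ha, alephCollapse_of_aleph0_le (ha.trans hab.le),
      Cardinal.aleph_lt_aleph, Nat.cast_lt]
    refine Finset.card_lt_card (Finset.ssubset_iff_of_subset
      (Finset.monotone_filter_right C fun _ _ h => h.trans hab.le) |>.2 ⟨b, ?_, ?_⟩)
    · exact Finset.mem_filter.2 ⟨hb, le_rfl⟩
    · exact fun h => (Finset.mem_filter.1 h).2.not_gt hab

theorem alephCollapse_le_iff (ha : a ∈ C) : alephCollapse C a ≤ alephCollapse C b ↔ a ≤ b := by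
  rw [← not_lt, alephCollapse_lt_iff ha, not_lt]

theorem alephCollapse_le (C : Finset Cardinal.{u}) (c : Cardinal.{u}) :
    alephCollapse C c ≤ ℵ_ (C.card : Ordinal.{u}) := by
  unfold alephCollapse
  split_ifs with h
  · exact h.le.trans (Cardinal.aleph0_le_aleph _)
  · rw [Cardinal.aleph_le_aleph, Nat.cast_le]
    exact Finset.card_filter_le _ _

theorem alephCollapse_add (a b : Cardinal.{u}) :
    alephCollapse C (a + b) = alephCollapse C a + alephCollapse C b := by
  wlog hab : a ≤ b generalizing a b
  · rw [add_comm a, add_comm (alephCollapse C a)]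
    exact this b a (le_of_not_ge hab)
  rcases lt_or_ge b ℵ₀ with hb | hb
  · have ha := hab.trans_lt hb
    simp only [alephCollapse_of_lt_aleph0, ha, hb, Cardinal.add_lt_aleph0]
  · rw [Cardinal.add_eq_right hb hab,
      Cardinal.add_eq_right (aleph0_le_alephCollapse_iff.2 hb) (alephCollapse_mono hab)]

theorem alephCollapse_sum {ι : Type u} [Finite ι] (f : ι → Cardinal.{u}) :
    alephCollapse C (Cardinal.sum f) = Cardinal.sum fun i => alephCollapse C (f i) := by
  have := Fintype.ofFinite ι
  simp only [cardinal_sum_eq_finset_sum]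
  let φ : Cardinal.{u} →+ Cardinal.{u} :=
    ⟨⟨alephCollapse C, alephCollapse_eq_zero_iff.2 rfl⟩, alephCollapse_add⟩
  exact map_sum φ f Finset.univ

end AlephCollapse

/-! ### Representatives of the elements of a set -/

section Representatives

variable {A : Type*} {𝓕 : Set (Set A)} {S : Set A}

/-- The members of `𝓕` that contain `a`. -/
def signature (𝓕 : Set (Set A)) (a : A) : Set (Set A) := {Y | Y ∈ 𝓕 ∧ a ∈ Y}

/-- A fixed element of `S` that lies in the same members of `𝓕` as `a`, the same one for all `a`
with the same signature. -/
noncomputable def representative (𝓕 : Set (Set A)) (S : Set A) (a : S) : A :=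
  (Set.rangeSplitting (fun b : S => signature 𝓕 b)
    (Set.rangeFactorization (fun b : S => signature 𝓕 b) a) : S)

theorem representative_mem (a : S) : representative 𝓕 S a ∈ S := Subtype.property _

theorem representative_mem_iff (a : S) {Y : Set A} (hY : Y ∈ 𝓕) :
    representative 𝓕 S a ∈ Y ↔ (a : A) ∈ Y := by
  have h : signature 𝓕 (representative 𝓕 S a) = signature 𝓕 a :=
    Set.apply_rangeSplitting (fun b : S => signature 𝓕 b) _
  simpa [signature, hY] using Set.ext_iff.1 h Y

theorem finite_range_representative (h : 𝓕.Finite) (S : Set A) :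
    (Set.range (representative 𝓕 S)).Finite := by
  have : Finite (Set.range fun b : S => signature 𝓕 b) :=
    h.finite_subsets.subset (Set.range_subset_iff.2 fun b Y hY => hY.1)
  exact (Set.finite_range fun σ =>
    ((Set.rangeSplitting (fun b : S => signature 𝓕 b) σ : S) : A)).subset
    (Set.range_subset_iff.2 fun a => ⟨_, rfl⟩)

end Representatives

/-! ### Satisfaction in terms of cardinals -/

namespace KripkeModel

open OrdArith

variable {P : Type v}

section Counting

variable (M : KripkeModel.{u, v} P)

/-- The number of successors of `s` that lie in `X`. -/
def count (s : M.World) (X : Set M.World) : Cardinal.{u} := #{t : M.World // M.R s t ∧ t ∈ X}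

/-- The number of two-step paths from `s` that end in `X`. -/
def pairs (s : M.World) (X : Set M.World) : Cardinal.{u} :=
  #{q : M.World × M.World // M.R s q.1 ∧ M.R q.1 q.2 ∧ q.2 ∈ X}

/-- The worlds that see an element of `X`, the set usually denoted `◇X`. -/
def dia (X : Set M.World) : Set M.World := {t | ∃ w, M.R t w ∧ w ∈ X}

/-- The worlds with at least as many successors in `X` as there are two-step paths from `s`. For a
successor of `s`, this says that its summand in the sum that evaluates a double box at `s` is as
large as it can be. -/
def heavy (s : M.World) (X : Set M.World) : Set M.World := {t | M.pairs s Set.univ ≤ M.count t X}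

variable {M} {s : M.World} {X : Set M.World}

theorem count_univ (s : M.World) : M.count s Set.univ = M.kap s :=
  Cardinal.mk_congr (Equiv.subtypeEquivRight fun _ => and_iff_left trivial)

theorem count_eq_zero_iff : M.count s X = 0 ↔ ∀ t, M.R s t → t ∉ X := by
  simp [count, Cardinal.mk_eq_zero_iff, isEmpty_subtype]

theorem mem_dia_iff {t : M.World} : t ∈ M.dia X ↔ M.count t X ≠ 0 := by
  simp [dia, count_eq_zero_iff]

theorem pairs_eq_sum {T : Set M.World} (hT : T ⊆ M.succs s)
    (h : ∀ t w, M.R s t → M.R t w → w ∈ X → t ∈ T) :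
    M.pairs s X = Cardinal.sum fun t : T => M.count t X := by
  unfold pairs count
  rw [← Cardinal.mk_sigma]
  exact Cardinal.mk_congr
    { toFun := fun q => ⟨⟨q.1.1, h _ _ q.2.1 q.2.2.1 q.2.2.2⟩, ⟨q.1.2, q.2.2⟩⟩
      invFun := fun q => ⟨(q.1, q.2), hT q.1.2, q.2.2⟩ }

theorem pairs_eq_sum_dia (s : M.World) (X : Set M.World) :
    M.pairs s X = Cardinal.sum fun t : {t | M.R s t ∧ t ∈ M.dia X} => M.count t X :=
  pairs_eq_sum (fun _ ht => ht.1) fun _ w ht hw hwX => ⟨ht, w, hw, hwX⟩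

theorem pairs_le_count_mul {b : Cardinal.{u}} (h : ∀ t, M.R s t → M.count t X ≤ b) :
    M.pairs s X ≤ M.count s (M.dia X) * b := by
  rw [pairs_eq_sum_dia]
  exact le_of_le_of_eq (Cardinal.sum_le_sum _ (fun _ => b) fun t => h t t.2.1)
    (Cardinal.sum_const' _ b)

theorem count_dia_le_pairs (s : M.World) (X : Set M.World) : M.count s (M.dia X) ≤ M.pairs s X := by
  rw [pairs_eq_sum_dia]
  calc M.count s (M.dia X)
      = Cardinal.sum fun _ : {t | M.R s t ∧ t ∈ M.dia X} => (1 : Cardinal.{u}) := by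
        rw [Cardinal.sum_const', mul_one]
        rfl
    _ ≤ _ := Cardinal.sum_le_sum _ _ fun t =>
        Cardinal.one_le_iff_ne_zero.2 (mem_dia_iff.1 t.2.2)

theorem count_le_pairs {t : M.World} (ht : M.R s t) (X : Set M.World) :
    M.count t X ≤ M.pairs s X :=
  Cardinal.mk_le_of_injective
    (f := fun w : {w // M.R t w ∧ w ∈ X} =>
      (⟨(t, w), ht, w.2⟩ : {q : M.World × M.World // M.R s q.1 ∧ M.R q.1 q.2 ∧ q.2 ∈ X}))
    fun _ _ h => Subtype.ext (Prod.ext_iff.1 (Subtype.ext_iff.1 h)).2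

theorem pairs_union_le (s : M.World) (X Y : Set M.World) :
    M.pairs s (X ∪ Y) ≤ M.pairs s X + M.pairs s Y :=
  (Cardinal.mk_subtype_mono fun _ ⟨ht, hw, hwXY⟩ =>
    hwXY.imp (fun h => ⟨ht, hw, h⟩) fun h => ⟨ht, hw, h⟩).trans <|
  Cardinal.mk_union_le {q : M.World × M.World | M.R s q.1 ∧ M.R q.1 q.2 ∧ q.2 ∈ X}
    {q | M.R s q.1 ∧ M.R q.1 q.2 ∧ q.2 ∈ Y}

theorem count_heavy_eq_zero_iff :
    M.count s (M.heavy s X) = 0 ↔ ∀ t, M.R s t → M.count t X < M.pairs s Set.univ := by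
  simp [count_eq_zero_iff, heavy]

theorem pairs_lt_iff {c : Cardinal.{u}} (hc : c.IsRegular) :
    M.pairs s X < c ↔ M.count s (M.dia X) < c ∧ ∀ t, M.R s t → M.count t X < c := by
  refine ⟨fun h => ⟨(count_dia_le_pairs s X).trans_lt h,
    fun t ht => (count_le_pairs ht X).trans_lt h⟩, fun ⟨hdia, hcount⟩ => ?_⟩
  rw [pairs_eq_sum_dia]
  exact Cardinal.sum_lt_of_isRegular hc hdia fun t => hcount t t.2.1

end Counting

section Satisfaction

variable {M : KripkeModel.{u, v} P}

namespace Enumeration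

variable (e : M.Enumeration) {s : M.World}

theorem card_hOn (X : Set M.World) (γ : Set.Iio (M.lam s).ord) :
    (e.hOn s X γ).card = M.count (e.f s γ) X :=
  (card_pullType _).trans (Cardinal.mk_congr (Equiv.subtypeSubtypeEquivSubtypeInter _ _))

theorem card_transSum_hOn (s : M.World) (X : Set M.World) :
    (transSum (e.hOn s X)).card = M.pairs s X := by
  rw [card_transSum _ (e.f s),
    pairs_eq_sum (T := M.liveSuccs s) (fun _ ht => ht.1) fun _ w ht hw _ => ⟨ht, w, hw⟩]
  simp only [card_hOn, Equiv.apply_symm_apply]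

theorem card_transSum_h (s : M.World) : (transSum (e.h s)).card = M.pairs s Set.univ := by
  rw [card_transSum _ (e.f s),
    pairs_eq_sum (T := M.liveSuccs s) (fun _ ht => ht.1) fun _ w ht hw _ => ⟨ht, w, hw⟩]
  simp only [h, Cardinal.card_ord, Equiv.apply_symm_apply, count_univ]

theorem hOn_le (X : Set M.World) (γ : Set.Iio (M.lam s).ord) :
    e.hOn s X γ ≤ (M.pairs s Set.univ).ord :=
  (pullType_le _).trans <| Cardinal.ord_le_ord.2 <|
    count_univ (M := M) _ ▸ count_le_pairs (e.f s γ).2.1 _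

theorem lam_le_pairs (s : M.World) : M.lam s ≤ M.pairs s Set.univ := by
  refine le_trans ?_ (count_dia_le_pairs s Set.univ)
  exact Cardinal.mk_subtype_mono fun t ⟨ht, w, hw⟩ => ⟨ht, w, hw, trivial⟩

theorem transSum_hOn_le (s : M.World) (X : Set M.World) :
    transSum (e.hOn s X) ≤ (M.pairs s Set.univ).ord * (M.pairs s Set.univ).ord :=
  (partialSum_le_mul _ (e.hOn_le X) _).trans
    (mul_le_mul_right (Cardinal.ord_le_ord.2 (lam_le_pairs s)) _)

theorem mk_ord_le_hOn (X : Set M.World) (h : M.pairs s Set.univ ≠ 0) :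
    #{t : M.liveSuccs s // (M.pairs s Set.univ).ord ≤ e.hOn s X ((e.f s).symm t)} =
      M.count s (M.heavy s X) := by
  have mem_heavy (t : M.liveSuccs s) :
      (M.pairs s Set.univ).ord ≤ e.hOn s X ((e.f s).symm t) ↔ (t : M.World) ∈ M.heavy s X := by
    rw [Cardinal.ord_le, card_hOn, Equiv.apply_symm_apply]
    rfl
  have live_of_heavy {t : M.World} (ht : t ∈ M.heavy s X) : ∃ w, M.R t w := by
    obtain ⟨w, hw, -⟩ := mem_dia_iff.2 ((pos_iff_ne_zero.2 h).trans_le ht).ne'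
    exact ⟨w, hw⟩
  exact Cardinal.mk_congr
    { toFun := fun t => ⟨t.1, t.1.2.1, (mem_heavy _).1 t.2⟩
      invFun := fun t => ⟨⟨t, t.2.1, live_of_heavy t.2.2⟩, (mem_heavy _).2 t.2.2⟩ }

theorem mul_self_le_transSum_hOn_iff (hc : (M.pairs s Set.univ).IsRegular) (X : Set M.World) :
    (M.pairs s Set.univ).ord * (M.pairs s Set.univ).ord ≤ transSum (e.hOn s X) ↔
      M.pairs s Set.univ ≤ M.count s (M.heavy s X) := by
  rw [← e.mk_ord_le_hOn X hc.ne_zero]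
  exact mul_self_le_transSum_iff (e.f s) hc (Cardinal.ord_le_ord.2 (lam_le_pairs s)) (e.hOn_le X)

theorem transSum_hOn_lt_iff (hc : (M.pairs s Set.univ).IsRegular) (X : Set M.World) :
    transSum (e.hOn s X) < (M.pairs s Set.univ).ord ↔
      M.count s (M.heavy s X) = 0 ∧ M.count s (M.dia X) < M.pairs s Set.univ := by
  rw [Cardinal.lt_ord, card_transSum_hOn, pairs_lt_iff hc, count_heavy_eq_zero_iff, and_comm]

theorem classLT_transSum_hOn_iff (hc : (M.pairs s Set.univ).IsRegular) {ζ : Ordinal.{u}}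
    (hζ : M.pairs s Set.univ = ℵ_ ζ) (X : Set M.World) :
    ClassLT ζ (transSum (e.hOn s Xᶜ)) (transSum (e.hOn s X)) ↔
      M.count s (M.heavy s Xᶜ) < M.pairs s Set.univ ∧
      (M.pairs s Set.univ ≤ M.count s (M.heavy s X) ∨
        M.count s (M.heavy s Xᶜ) = 0 ∧ M.count s (M.dia Xᶜ) < M.pairs s Set.univ) := by
  have hω : ω_ ζ = (M.pairs s Set.univ).ord := by rw [hζ, Cardinal.ord_aleph]
  have le_of_compl_lt : transSum (e.hOn s Xᶜ) < ω_ ζ → ω_ ζ ≤ transSum (e.hOn s X) := by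
    rw [hω, Cardinal.lt_ord, Cardinal.ord_le, card_transSum_hOn, card_transSum_hOn]
    intro hlt
    by_contra! hlt'
    refine (Cardinal.add_lt_of_lt hc.aleph0_le hlt' hlt).not_ge ?_
    exact Set.union_compl_self X ▸ pairs_union_le s X Xᶜ
  rw [classLT_iff_of_le_mul_self (hω ▸ e.transSum_hOn_le s _) (hω ▸ e.transSum_hOn_le s _)
    le_of_compl_lt, hω, ← not_le, e.mul_self_le_transSum_hOn_iff hc,
    e.mul_self_le_transSum_hOn_iff hc, e.transSum_hOn_lt_iff hc, not_le]

end Enumeration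

/-- The set of worlds at which a formula is true. -/
def truthSet (e : M.Enumeration) (φ : DTML P) : Set M.World := {w | Sat e φ w}

theorem sat_box_iff (e : M.Enumeration) (φ : DTML P) (s : M.World) :
    Sat e (.box φ) s ↔
      (ℵ₀ ≤ M.count s Set.univ ∧ M.count s (truthSet e φ)ᶜ < M.count s (truthSet e φ)) ∨
      (M.count s Set.univ < ℵ₀ ∧ M.count s (truthSet e φ)ᶜ = 0) := by
  rw [count_univ, count_eq_zero_iff]
  simp only [Set.mem_compl_iff, not_not]
  rfl

theorem Regular.isRegular_pairs (hM : M.Regular) {s : M.World} (h : ℵ₀ ≤ M.pairs s Set.univ) :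
    (M.pairs s Set.univ).IsRegular := by
  simpa [pairs] using hM s (by simpa [pairs] using h)

theorem regular_of_mk_lt_aleph_omega0 (h : #M.World < ℵ_ ω) : M.Regular := fun s hle => by
  refine isRegular_of_lt_aleph_omega0 hle ((Cardinal.mk_subtype_le _).trans_lt ?_)
  rw [Cardinal.mk_prod, Cardinal.lift_id]
  exact Cardinal.mul_lt_of_lt (Cardinal.aleph0_le_aleph ω) h h

theorem sat_boxbox_iff (hM : M.Regular) (e : M.Enumeration) (φ : DTML P) (s : M.World) :
    Sat e (.boxbox φ) s ↔
      (ℵ₀ ≤ M.pairs s Set.univ ∧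
        M.count s (M.heavy s (truthSet e φ)ᶜ) < M.pairs s Set.univ ∧
        (M.pairs s Set.univ ≤ M.count s (M.heavy s (truthSet e φ)) ∨
          M.count s (M.heavy s (truthSet e φ)ᶜ) = 0 ∧
            M.count s (M.dia (truthSet e φ)ᶜ) < M.pairs s Set.univ)) ∨
      (M.pairs s Set.univ < ℵ₀ ∧ M.count s (M.dia (truthSet e φ)ᶜ) = 0) := by
  rw [Sat, e.card_transSum_h s]
  refine or_congr ⟨?_, ?_⟩ (and_congr_right fun _ => ?_)
  · rintro ⟨ζ, hζ, h⟩
    have hle : ℵ₀ ≤ M.pairs s Set.univ := hζ ▸ Cardinal.aleph0_le_aleph ζ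
    exact ⟨hle, (e.classLT_transSum_hOn_iff (hM.isRegular_pairs hle) hζ _).1 h⟩
  · rintro ⟨hle, h⟩
    obtain ⟨ζ, hζ⟩ := Cardinal.mem_range_aleph_iff.2 hle
    exact ⟨ζ, hζ.symm, (e.classLT_transSum_hOn_iff (hM.isRegular_pairs hle) hζ.symm _).2 h⟩
  · simp only [count_eq_zero_iff, dia, truthSet, Set.mem_ofPred_eq, Set.mem_compl_iff, not_exists,
      not_and, not_not]
    exact forall_congr' fun _ => forall_comm.trans <| by tauto

end Satisfaction

/-! ### The collapsed model -/

section Representatives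

variable {M : KripkeModel.{u, v} P} (𝓧 : Set (Set M.World))

/-- The sets of worlds whose numbers of elements among the successors of `s` decide the modal
formulas at `s`, if `𝓧` contains the truth sets of their immediate subformulas and the complements
of these. -/
def tests (s : M.World) : Set (Set M.World) := 𝓧 ∪ M.heavy s '' 𝓧 ∪ M.dia '' 𝓧

/-- One successor of `s` for each way of meeting the test sets at `s`. -/
def reps (s : M.World) : Set M.World := Set.range (representative (tests 𝓧 s) (M.succs s))

/-- The number of successors of `s` that are represented by `t`. -/
def mult (s t : M.World) : Cardinal.{u} :=
  #{a : M.succs s // representative (tests 𝓧 s) (M.succs s) a = t}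

variable {𝓧} {s t : M.World} {X : Set M.World}

theorem mem_tests (h : X ∈ 𝓧) (s : M.World) : X ∈ tests 𝓧 s := .inl (.inl h)

theorem heavy_mem_tests (h : X ∈ 𝓧) (s : M.World) : M.heavy s X ∈ tests 𝓧 s :=
  .inl (.inr (Set.mem_image_of_mem _ h))

theorem dia_mem_tests (h : X ∈ 𝓧) (s : M.World) : M.dia X ∈ tests 𝓧 s :=
  .inr (Set.mem_image_of_mem _ h)

theorem finite_reps (h : 𝓧.Finite) (s : M.World) : (reps 𝓧 s).Finite :=
  finite_range_representative ((h.union (h.image _)).union (h.image _)) _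

theorem R_of_mem_reps (h : t ∈ reps 𝓧 s) : M.R s t := by
  obtain ⟨a, rfl⟩ := h
  exact representative_mem a

theorem mem_reps_of_mult_ne_zero (h : mult 𝓧 s t ≠ 0) : t ∈ reps 𝓧 s := by
  obtain ⟨a, ha⟩ := Cardinal.mk_ne_zero_iff.1 h
  exact ⟨a, ha⟩

theorem count_eq_sum_mult {W : Set M.World} (hW : reps 𝓧 s ⊆ W) (hX : X ∈ tests 𝓧 s) :
    M.count s X = Cardinal.sum fun t : {t : W // (t : M.World) ∈ X} => mult 𝓧 s t := by
  unfold count mult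
  rw [← Cardinal.mk_sigma]
  exact Cardinal.mk_congr
    { toFun := fun a => ⟨⟨⟨_, hW ⟨⟨a, a.2.1⟩, rfl⟩⟩, (representative_mem_iff _ hX).2 a.2.2⟩,
        ⟨⟨a, a.2.1⟩, rfl⟩⟩
      invFun := fun p => ⟨p.2.1, p.2.1.2, (representative_mem_iff _ hX).1 (p.2.2.symm.subst p.1.2)⟩
      right_inv := by
        rintro ⟨⟨⟨t, ht⟩, htX⟩, ⟨a, ha⟩⟩
        dsimp only at ha
        subst ha
        rfl }

variable (𝓧)

/-- The representatives `t` of the successors of `s` together with the sets `F t`. -/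
def expand (F : M.World → Set M.World) (s : M.World) : Set M.World :=
  ⋃ t ∈ reps 𝓧 s, insert t (F t)

/-- The worlds other than `s` that the evaluation of a formula at `s` visits when only
representatives of successors are considered. -/
def reach : DTML P → M.World → Set M.World
  | .prop _ => fun _ => ∅
  | .neg φ => reach φ
  | .conj φ ψ => fun s => reach φ s ∪ reach ψ s
  | .box φ => expand 𝓧 (reach φ)
  | .boxbox φ => expand 𝓧 (expand 𝓧 (reach φ))

variable {𝓧}

theorem expand_subset_iff {F : M.World → Set M.World} {W : Set M.World} :
    expand 𝓧 F s ⊆ W ↔ ∀ t ∈ reps 𝓧 s, t ∈ W ∧ F t ⊆ W := by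
  simp [expand, Set.insert_subset_iff]

theorem finite_expand (h : 𝓧.Finite) {F : M.World → Set M.World} (hF : ∀ t, (F t).Finite)
    (s : M.World) : (expand 𝓧 F s).Finite :=
  (finite_reps h s).biUnion fun t _ => (hF t).insert t

theorem finite_reach (h : 𝓧.Finite) (φ : DTML P) : ∀ s, (reach 𝓧 φ s).Finite := by
  induction φ with
  | prop _ => exact fun _ => Set.finite_empty
  | neg _ ih => exact ih
  | conj _ _ ihφ ihψ => exact fun s => (ihφ s).union (ihψ s)
  | box _ ih => exact finite_expand h ih
  | boxbox _ ih => exact finite_expand h (finite_expand h ih)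

/-- The truth sets, and their complements, of the subformulas of a formula that stand directly below
a modality. -/
def boxedSets (e : M.Enumeration) : DTML P → Set (Set M.World)
  | .prop _ => ∅
  | .neg φ => boxedSets e φ
  | .conj φ ψ => boxedSets e φ ∪ boxedSets e ψ
  | .box φ | .boxbox φ => {truthSet e φ, (truthSet e φ)ᶜ} ∪ boxedSets e φ

theorem finite_boxedSets (e : M.Enumeration) (φ : DTML P) : (boxedSets e φ).Finite := by
  induction φ with
  | prop _ => exact Set.finite_empty
  | neg _ ih => exact ih
  | conj _ _ ihφ ihψ => exact ihφ.union ihψ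
  | box _ ih | boxbox _ ih => exact (Set.toFinite _).union ih

end Representatives

section Collapsed

/-- A type of cardinality `ℵ_ n`, where `n` is the number of elements of `C`. It serves to make
copies of worlds. -/
def Label (C : Finset Cardinal.{u}) : Type u := (ℵ_ (C.card : Ordinal.{u})).out

theorem mk_label (C : Finset Cardinal.{u}) : #(Label C) = ℵ_ (C.card : Ordinal.{u}) :=
  Cardinal.mk_out _

instance nonempty_label (C : Finset Cardinal.{u}) : Nonempty (Label C) := by
  rw [← Cardinal.mk_ne_zero_iff, mk_label]
  exact (Cardinal.aleph_pos _).ne'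

theorem exists_mk_labels_eq (C : Finset Cardinal.{u}) (c : Cardinal.{u}) :
    ∃ A : Set (Label C), #A = alephCollapse C c :=
  Cardinal.le_mk_iff_exists_set.1 ((alephCollapse_le C c).trans_eq (mk_label C).symm)

/-- A set of `alephCollapse C c` labels. -/
noncomputable def labels (C : Finset Cardinal.{u}) (c : Cardinal.{u}) : Set (Label C) :=
  (exists_mk_labels_eq C c).choose

theorem mk_labels (C : Finset Cardinal.{u}) (c : Cardinal.{u}) :
    #(labels C c) = alephCollapse C c := (exists_mk_labels_eq C c).choose_spec

variable {M : KripkeModel.{u, v} P}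

/-- The model whose worlds are labelled copies of the worlds in `W`, and in which every copy of `s`
sees `alephCollapse C (mult 𝓧 s t)` copies of `t`. -/
abbrev collapsed (𝓧 : Set (Set M.World)) (W : Set M.World) [Nonempty W] (C : Finset Cardinal.{u}) :
    KripkeModel.{u, v} P where
  World := W × Label C
  nonempty := inferInstance
  R x y := y.2 ∈ labels C (mult 𝓧 (x.1 : M.World) y.1)
  V p := {x | (x.1 : M.World) ∈ M.V p}

variable {𝓧 : Set (Set M.World)} {W : Set M.World} [Nonempty W] {C : Finset Cardinal.{u}}

theorem mk_world_collapsed_lt (hW : W.Finite) : #(collapsed 𝓧 W C).World < ℵ_ ω := by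
  change #(W × Label C) < ℵ_ ω
  rw [Cardinal.mk_prod, Cardinal.lift_id, Cardinal.lift_id, mk_label]
  refine Cardinal.mul_lt_of_lt (Cardinal.aleph0_le_aleph ω)
    (hW.lt_aleph0.trans_le (Cardinal.aleph0_le_aleph ω)) ?_
  exact Cardinal.aleph_lt_aleph.2 (Ordinal.natCast_lt_omega0 _)

variable {x y : (collapsed 𝓧 W C).World} {X : Set M.World} {Y : Set (collapsed 𝓧 W C).World}

theorem mem_reps_of_collapsed_R (h : (collapsed 𝓧 W C).R x y) : (y.1 : M.World) ∈ reps 𝓧 x.1 := by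
  refine mem_reps_of_mult_ne_zero fun hmult => ?_
  have : #(labels C (mult 𝓧 (x.1 : M.World) y.1)) = 0 := by
    rw [mk_labels, alephCollapse_eq_zero_iff, hmult]
  exact (Cardinal.mk_eq_zero_iff.1 this).false ⟨_, h⟩

theorem count_collapsed [Finite W] (hx : reps 𝓧 (x.1 : M.World) ⊆ W)
    (hX : X ∈ tests 𝓧 (x.1 : M.World))
    (hY : ∀ y, (collapsed 𝓧 W C).R x y → (y ∈ Y ↔ (y.1 : M.World) ∈ X)) :
    (collapsed 𝓧 W C).count x Y = alephCollapse C (M.count x.1 X) := by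
  rw [count_eq_sum_mult hx hX, alephCollapse_sum]
  simp only [← mk_labels]
  rw [← Cardinal.mk_sigma]
  exact Cardinal.mk_congr
    { toFun := fun y => ⟨⟨y.1.1, (hY _ y.2.1).1 y.2.2⟩, ⟨y.1.2, y.2.1⟩⟩
      invFun := fun p => ⟨(p.1.1, p.2.1), p.2.2, (hY (p.1.1, p.2.1) p.2.2).2 p.1.2⟩ }

theorem count_univ_collapsed [Finite W] (h𝓧 : Set.univ ∈ 𝓧) (hx : reps 𝓧 (x.1 : M.World) ⊆ W) :
    (collapsed 𝓧 W C).count x Set.univ = alephCollapse C (M.count x.1 Set.univ) :=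
  count_collapsed hx (mem_tests h𝓧 _) fun _ _ => iff_of_true trivial trivial

theorem count_dia_collapsed [Finite W] (hX : X ∈ 𝓧) (hx : reps 𝓧 (x.1 : M.World) ⊆ W)
    (hx' : ∀ t ∈ reps 𝓧 (x.1 : M.World), reps 𝓧 t ⊆ W)
    (hY : ∀ y, (collapsed 𝓧 W C).R x y → ∀ z, (collapsed 𝓧 W C).R y z →
      (z ∈ Y ↔ (z.1 : M.World) ∈ X)) :
    (collapsed 𝓧 W C).count x ((collapsed 𝓧 W C).dia Y) =
      alephCollapse C (M.count x.1 (M.dia X)) := by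
  refine count_collapsed hx (dia_mem_tests hX _) fun y hy => ?_
  rw [mem_dia_iff, mem_dia_iff,
    count_collapsed (hx' _ (mem_reps_of_collapsed_R hy)) (mem_tests hX _) (hY y hy), ne_eq,
    alephCollapse_eq_zero_iff]

theorem pairs_collapsed_le [Finite W] (h𝓧 : Set.univ ∈ 𝓧) (hx : reps 𝓧 (x.1 : M.World) ⊆ W)
    (hx' : ∀ t ∈ reps 𝓧 (x.1 : M.World), reps 𝓧 t ⊆ W) :
    (collapsed 𝓧 W C).pairs x Set.univ ≤
      alephCollapse C (M.pairs x.1 Set.univ) * alephCollapse C (M.pairs x.1 Set.univ) := by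
  refine (pairs_le_count_mul (b := alephCollapse C (M.pairs x.1 Set.univ)) fun y hy => ?_).trans
    (mul_le_mul_left ?_ _)
  · have hy' := mem_reps_of_collapsed_R hy
    rw [count_univ_collapsed h𝓧 (hx' _ hy')]
    exact alephCollapse_mono (count_le_pairs (R_of_mem_reps hy') _)
  · rw [count_dia_collapsed (Y := Set.univ) h𝓧 hx hx' fun _ _ _ _ => iff_of_true trivial trivial]
    exact alephCollapse_mono (count_dia_le_pairs _ _)

theorem pairs_collapsed [Finite W] (h𝓧 : Set.univ ∈ 𝓧) (hx : reps 𝓧 (x.1 : M.World) ⊆ W)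
    (hx' : ∀ t ∈ reps 𝓧 (x.1 : M.World), reps 𝓧 t ⊆ W) (hc : (M.pairs x.1 Set.univ).IsRegular) :
    (collapsed 𝓧 W C).pairs x Set.univ = alephCollapse C (M.pairs x.1 Set.univ) := by
  refine le_antisymm ((pairs_collapsed_le h𝓧 hx hx').trans_eq
    (Cardinal.mul_eq_self (aleph0_le_alephCollapse_iff.2 hc.aleph0_le))) ?_
  have many_dia_or_heavy := lt_irrefl (M.pairs x.1 Set.univ)
  rw [pairs_lt_iff hc, ← count_heavy_eq_zero_iff, not_and_or, not_lt] at many_dia_or_heavy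
  rcases many_dia_or_heavy with many_dia | heavy_ne_zero
  · refine (alephCollapse_mono many_dia).trans ?_
    rw [← count_dia_collapsed (Y := Set.univ) h𝓧 hx hx' fun _ _ _ _ => iff_of_true trivial trivial]
    exact count_dia_le_pairs _ _
  · rw [← alephCollapse_eq_zero_iff (C := C), ← count_collapsed
      (Y := {y | (y.1 : M.World) ∈ M.heavy x.1 Set.univ}) hx (heavy_mem_tests h𝓧 _)
      fun _ _ => Iff.rfl, count_eq_zero_iff] at heavy_ne_zero
    push Not at heavy_ne_zero
    obtain ⟨y, hy, y_heavy : M.pairs x.1 Set.univ ≤ M.count y.1 Set.univ⟩ := heavy_ne_zero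
    refine (alephCollapse_mono y_heavy).trans ?_
    rw [← count_univ_collapsed h𝓧 (hx' _ (mem_reps_of_collapsed_R hy))]
    exact count_le_pairs hy _

theorem count_heavy_collapsed [Finite W] (hX : X ∈ 𝓧) (hx : reps 𝓧 (x.1 : M.World) ⊆ W)
    (hx' : ∀ t ∈ reps 𝓧 (x.1 : M.World), reps 𝓧 t ⊆ W)
    (hY : ∀ y, (collapsed 𝓧 W C).R x y → ∀ z, (collapsed 𝓧 W C).R y z →
      (z ∈ Y ↔ (z.1 : M.World) ∈ X))
    (hpairs : (collapsed 𝓧 W C).pairs x Set.univ = alephCollapse C (M.pairs x.1 Set.univ))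
    (hC : M.pairs x.1 Set.univ ∈ C) :
    (collapsed 𝓧 W C).count x ((collapsed 𝓧 W C).heavy x Y) =
      alephCollapse C (M.count x.1 (M.heavy x.1 X)) := by
  refine count_collapsed hx (heavy_mem_tests hX _) fun y hy => ?_
  rw [heavy, heavy, Set.mem_ofPred_eq, Set.mem_ofPred_eq, hpairs,
    count_collapsed (hx' _ (mem_reps_of_collapsed_R hy)) (mem_tests hX _) (hY y hy),
    alephCollapse_le_iff hC]

theorem sat_box_collapsed_iff [Finite W] (e : M.Enumeration)
    (e' : (collapsed 𝓧 W C).Enumeration) {φ : DTML P} (h𝓧 : Set.univ ∈ 𝓧)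
    (hφ : truthSet e φ ∈ 𝓧) (hφ' : (truthSet e φ)ᶜ ∈ 𝓧) (hx : reps 𝓧 (x.1 : M.World) ⊆ W)
    (hC : M.count x.1 (truthSet e φ) ∈ C)
    (ih : ∀ y, (collapsed 𝓧 W C).R x y → (Sat e' φ y ↔ Sat e φ y.1)) :
    Sat e' (.box φ) x ↔ Sat e (.box φ) x.1 := by
  have ih' : ∀ y, (collapsed 𝓧 W C).R x y →
      (y ∈ (truthSet e' φ)ᶜ ↔ (y.1 : M.World) ∈ (truthSet e φ)ᶜ) :=
    fun y hy => not_congr (ih y hy)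
  rw [sat_box_iff, sat_box_iff, count_univ_collapsed h𝓧 hx,
    count_collapsed (Y := truthSet e' φ) hx (mem_tests hφ _) ih,
    count_collapsed hx (mem_tests hφ' _) ih',
    alephCollapse_lt_iff hC, aleph0_le_alephCollapse_iff, alephCollapse_lt_aleph0_iff,
    alephCollapse_eq_zero_iff]

theorem sat_boxbox_collapsed_iff [Finite W] (hM : M.Regular) (hN : (collapsed 𝓧 W C).Regular)
    (e : M.Enumeration) (e' : (collapsed 𝓧 W C).Enumeration) {φ : DTML P} (h𝓧 : Set.univ ∈ 𝓧)
    (hφ : truthSet e φ ∈ 𝓧) (hφ' : (truthSet e φ)ᶜ ∈ 𝓧) (hx : reps 𝓧 (x.1 : M.World) ⊆ W)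
    (hx' : ∀ t ∈ reps 𝓧 (x.1 : M.World), reps 𝓧 t ⊆ W) (hC : M.pairs x.1 Set.univ ∈ C)
    (ih : ∀ y, (collapsed 𝓧 W C).R x y → ∀ z, (collapsed 𝓧 W C).R y z →
      (Sat e' φ z ↔ Sat e φ z.1)) :
    Sat e' (.boxbox φ) x ↔ Sat e (.boxbox φ) x.1 := by
  have ih' : ∀ y, (collapsed 𝓧 W C).R x y → ∀ z, (collapsed 𝓧 W C).R y z →
      (z ∈ (truthSet e' φ)ᶜ ↔ (z.1 : M.World) ∈ (truthSet e φ)ᶜ) :=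
    fun y hy z hz => not_congr (ih y hy z hz)
  rw [sat_boxbox_iff hN, sat_boxbox_iff hM, count_dia_collapsed hφ' hx hx' ih',
    alephCollapse_eq_zero_iff]
  rcases lt_or_ge (M.pairs x.1 Set.univ) ℵ₀ with hlt | hle
  · have hlt' : (collapsed 𝓧 W C).pairs x Set.univ < ℵ₀ :=
      (pairs_collapsed_le h𝓧 hx hx').trans_lt <|
        Cardinal.mul_lt_aleph0 (alephCollapse_lt_aleph0_iff.2 hlt)
          (alephCollapse_lt_aleph0_iff.2 hlt)
    simp only [hlt, hlt', hlt.not_ge, hlt'.not_ge, false_and, false_or, true_and]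
  · have hpairs := pairs_collapsed (C := C) h𝓧 hx hx' (hM.isRegular_pairs hle)
    rw [hpairs, count_heavy_collapsed (Y := truthSet e' φ) hφ hx hx' ih hpairs hC,
      count_heavy_collapsed hφ' hx hx' ih' hpairs hC, aleph0_le_alephCollapse_iff,
      alephCollapse_lt_aleph0_iff, alephCollapse_lt_iff hC, alephCollapse_lt_iff hC,
      alephCollapse_le_iff hC, alephCollapse_eq_zero_iff]

theorem sat_collapsed_iff [Finite W] (hM : M.Regular) (hN : (collapsed 𝓧 W C).Regular)
    (e : M.Enumeration) (e' : (collapsed 𝓧 W C).Enumeration) (h𝓧 : Set.univ ∈ 𝓧)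
    (hpairs : ∀ w ∈ W, M.pairs w Set.univ ∈ C) (hcount : ∀ w ∈ W, ∀ X ∈ 𝓧, M.count w X ∈ C)
    (φ : DTML P) (hφ : boxedSets e φ ⊆ 𝓧) (hx : reach 𝓧 φ (x.1 : M.World) ⊆ W) :
    Sat e' φ x ↔ Sat e φ x.1 := by
  induction φ generalizing x with
  | prop p => rfl
  | neg φ ih => exact not_congr (ih hφ hx)
  | conj φ ψ ihφ ihψ =>
    exact and_congr (ihφ (Set.union_subset_iff.1 hφ).1 (Set.union_subset_iff.1 hx).1)
      (ihψ (Set.union_subset_iff.1 hφ).2 (Set.union_subset_iff.1 hx).2)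
  | box φ ih =>
    have hreach := expand_subset_iff.1 hx
    simp only [boxedSets, Set.union_subset_iff, Set.pair_subset_iff] at hφ
    exact sat_box_collapsed_iff e e' h𝓧 hφ.1.1 hφ.1.2 (fun t ht => (hreach t ht).1)
      (hcount _ x.1.2 _ hφ.1.1) fun y hy => ih hφ.2 (hreach _ (mem_reps_of_collapsed_R hy)).2
  | boxbox φ ih =>
    have hreach := expand_subset_iff.1 hx
    have hreach' : ∀ t ∈ reps 𝓧 (x.1 : M.World), ∀ w ∈ reps 𝓧 t, w ∈ W ∧ reach 𝓧 φ w ⊆ W :=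
      fun t ht => expand_subset_iff.1 (hreach t ht).2
    simp only [boxedSets, Set.union_subset_iff, Set.pair_subset_iff] at hφ
    exact sat_boxbox_collapsed_iff hM hN e e' h𝓧 hφ.1.1 hφ.1.2 (fun t ht => (hreach t ht).1)
      (fun t ht w hw => (hreach' t ht w hw).1) (hpairs _ x.1.2) fun y hy z hz =>
        ih hφ.2 (hreach' _ (mem_reps_of_collapsed_R hy) _ (mem_reps_of_collapsed_R hz)).2

theorem exists_mk_world_lt_aleph_omega0 (hM : M.Regular) (e : M.Enumeration) (φ : DTML P)
    (s : M.World) :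
    ∃ N : KripkeModel.{u, v} P, #N.World < ℵ_ ω ∧
      ∃ x : N.World, ∀ e' : N.Enumeration, Sat e' φ x ↔ Sat e φ s := by
  let 𝓧 := insert Set.univ (boxedSets e φ)
  have finite_𝓧 : 𝓧.Finite := (finite_boxedSets e φ).insert _
  let W := insert s (reach 𝓧 φ s)
  have finite_W : W.Finite := (finite_reach finite_𝓧 φ s).insert s
  have : Finite W := finite_W
  have : Nonempty W := ⟨⟨s, Set.mem_insert _ _⟩⟩
  have finite_C : ((fun w => M.pairs w Set.univ) '' W ∪ Set.image2 M.count W 𝓧).Finite :=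
    (finite_W.image _).union (finite_W.image2 _ finite_𝓧)
  let C := finite_C.toFinset
  have hN : #(collapsed 𝓧 W C).World < ℵ_ ω := mk_world_collapsed_lt finite_W
  refine ⟨collapsed 𝓧 W C, hN, (⟨s, Set.mem_insert _ _⟩, Classical.arbitrary _), fun e' => ?_⟩
  exact sat_collapsed_iff hM (regular_of_mk_lt_aleph_omega0 hN) e e' (Set.mem_insert _ _)
    (fun w hw => finite_C.mem_toFinset.2 (.inl (Set.mem_image_of_mem _ hw)))
    (fun w hw X hX => finite_C.mem_toFinset.2 (.inr (Set.mem_image2_of_mem hw hX)))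
    φ (Set.subset_insert _ _) (Set.subset_insert _ _)

end Collapsed

end KripkeModel

theorem mainTheorem1 {P : Type v}
    (E : ∀ M : KripkeModel.{u, v} P, M.Enumeration) (φ : DTML P) :
    (∃ M : KripkeModel.{u, v} P, M.Regular ∧
        ∃ s : M.World, KripkeModel.Sat (E M) φ s) ↔
    (∃ M : KripkeModel.{u, v} P, M.Regular ∧ #M.World < ℵ_ (ω : Ordinal.{u}) ∧
        ∃ s : M.World, KripkeModel.Sat (E M) φ s) := by
  refine ⟨fun ⟨M, hM, s, hs⟩ => ?_, fun ⟨M, hM, _, s, hs⟩ => ⟨M, hM, s, hs⟩⟩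
  obtain ⟨N, hN, x, hx⟩ := KripkeModel.exists_mk_world_lt_aleph_omega0 hM (E M) φ s
  exact ⟨N, KripkeModel.regular_of_mk_lt_aleph_omega0 hN, hN, x, (hx (E N)).2 hs⟩
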